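/- Let $n\ge 2$ be an integer and let $M<0$ satisfy $M>-\frac{n^2}{(n+1)^2}$ (so $-1<M<0$). Consider the static conical defect $$ds^2=-(r^2-M)\,dt^2+\frac{dr^2}{r^2-M}+r^2\,d\phi^2,\qquad r\ge 0,\quad \phi\sim\phi+2\pi,$$ conformally completed by its boundary cylinder, with boundary metric $-dt^2+d\phi^2$. Causal futures and pasts $\mathcal J^\pm$ are taken in the completed spacetime, defined by piecewise $C^1$ causal curves, which may pass through the defect $r=0$. Symmetric $n$-to-$n$ setup. Let $x,\theta$ be real numbers with $0<x<\theta$ and $(n-1)\theta+x<2\pi$ (the $n$ input intervals of width $x$, whose neighbouring midpoints are $\theta$ apart, are pairwise separated). The input points are $c_i=(t,\phi)=(-x,(i-1)\theta)$ for $1\le i\le n$. Put $m=\lfloor (n+1)/2\rfloor$. The output points are $r_m=\left(\frac{n-1}2\theta,\frac{n-1}2\theta\right)$ and, for $i\ne m$, $r_i=\left(\pi-\frac\theta2,\phi_i\right)$, where - for $n$ odd, $\phi_i=-\pi+(i-1+\frac n2)\theta$ if $i<m$, and $\phi_i=\pi+(i-1-\frac n2)\theta$ if $i>m$; - for $n$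 even, $\phi_i=-\pi+(i+\frac{n-1}2)\theta$ if $i<m$, and $\phi_i=\pi+(i-\frac{n+1}2)\theta$ if $i>m$. For $j\neq k$ let $$J_{jk\to 1\cdots n}=\mathcal J^+(c_j)\cap\mathcal J^+(c_k)\cap\bigcap_{l=1}^n\mathcal J^-(r_l),$$ and say that holographic $n$-to-$n$ scattering is possible at $(\theta,x)$ if the graph on $\{1,\dots,n\}$ with an edge $jk$ whenever $J_{jk\to1\cdots n}\neq\emptyset$ is connected. Then: 1. For every allowed $(\theta,x)$, all the regions $J_{jk\to1\cdots n}$ with $j\ne k$ are empty, and holographic $n$-to-$n$ scattering is impossible. 2. Hence no competition among RT surfaces implies scattering. Here an RT candidate is a family of pairwise non-crossing spacelike geodesics, each deformable off the defect to a boundary arc, that joins the $2n$ endpoints of the input intervals in pairs. A geodesic of opening angle $\Delta\phi$ exists for $\Delta\phi<\pi/\sqrt{|M|}$, and with cutoff surface $r=1/\varepsilon$ its length is $2\log\left(\frac{2}{\sqrt{|M|}\,\varepsilon}\sin\frac{\sqrt{|M|}\,\Delta\phi}{2}\right)$. The length of a candidate is the sum over its geodesics, and is $+\infty$ if one of them does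 not exist. For every $\varepsilon>0$ and every condition $C$ on the lengths of all RT candidates that holds at some allowed $(\theta,x)$, it is not true that $C$ implies holographic scattering at all allowed $(\theta,x)$. For $n=2$ this is the points-based 2-to-2 statement with the bound $M>-4/9$. -/

import Mathlib

open Real Set

namespace ConicalDefect

noncomputable section

/-! ### The static conical defect and its conformal completion -/

/-- The static conical defect metric
`ds² = -(r² - M) dt² + dr² / (r² - M) + r² dφ²` (with `M < 0`), evaluated at radius `r` on the
tangent vector with coordinate components `(dt, dr, dφ)`. -/
def metric (M r dt dr dφ : ℝ) : ℝ :=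
  -(r ^ 2 - M) * dt ^ 2 + dr ^ 2 / (r ^ 2 - M) + r ^ 2 * dφ ^ 2

/-- The metric of the conformal completion, `-|M| dt² + dσ² + |M| sin² σ dφ²`, in the compactified
radial coordinate `σ ∈ [0, π/2]` given by `r = √|M| tan σ`.  The defect sits at `σ = 0` and the
conformal boundary, with metric proportional to `-dt² + dφ²`, at `σ = π/2`. -/
def conformalMetric (M σ dt dσ dφ : ℝ) : ℝ :=
  M * dt ^ 2 + dσ ^ 2 - M * sin σ ^ 2 * dφ ^ 2

/-- The change of radial coordinate. -/
def radius (M σ : ℝ) : ℝ := √(-M) * tan σ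

theorem hasDerivAt_radius (M : ℝ) {σ : ℝ} (h : cos σ ≠ 0) :
    HasDerivAt (radius M) (√(-M) / cos σ ^ 2) σ := by
  have h1 := (Real.hasDerivAt_tan h).const_mul (√(-M))
  have h2 : √(-M) * (1 / cos σ ^ 2) = √(-M) / cos σ ^ 2 := by ring
  rw [h2] at h1
  exact h1

/-- In the interior, `conformalMetric` is the physical metric multiplied by `cos² σ`. -/
theorem conformalMetric_eq {M σ : ℝ} (hM : M < 0) (h : cos σ ≠ 0) (dt dσ dφ : ℝ) :
    conformalMetric M σ dt dσ dφ =
      cos σ ^ 2 * metric M (radius M σ) dt (√(-M) / cos σ ^ 2 * dσ) dφ := by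
  have hs : √(-M) ^ 2 = -M := Real.sq_sqrt (by linarith)
  have hsc : sin σ ^ 2 = 1 - cos σ ^ 2 := by
    have := Real.sin_sq_add_cos_sq σ
    linarith
  have hr : radius M σ ^ 2 - M = -M / cos σ ^ 2 := by
    unfold radius
    rw [mul_pow, hs, Real.tan_eq_sin_div_cos, div_pow, hsc]
    field_simp
    ring
  have hr2 : radius M σ ^ 2 = -M / cos σ ^ 2 + M := by linarith
  have hM' : M ≠ 0 := hM.ne
  unfold metric conformalMetric
  rw [hr, hr2, mul_pow, div_pow, hs, hsc]
  field_simp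
  ring

/-- Coordinates `(t, σ, φ)` on the conformally completed spacetime (with `φ ∈ ℝ` not yet
periodically identified). -/
structure Coord where
  t : ℝ
  σ : ℝ
  φ : ℝ
  σ_nonneg : 0 ≤ σ
  σ_le : σ ≤ π / 2

/-- Two coordinate triples describe the same event when they agree up to `φ ∼ φ + 2π`; at the
defect `σ = 0` the angle is immaterial. -/
def eventSetoid : Setoid Coord where
  r p q := p.t = q.t ∧ p.σ = q.σ ∧ (p.σ = 0 ∨ ∃ k : ℤ, q.φ = p.φ + 2 * π * k)
  iseqv := by
    refine ⟨fun p => ⟨rfl, rfl, Or.inr ⟨0, by simp⟩⟩, ?_, ?_⟩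
    · rintro p q ⟨h1, h2, h3⟩
      refine ⟨h1.symm, h2.symm, ?_⟩
      rcases h3 with h3 | ⟨k, hk⟩
      · exact Or.inl (h2 ▸ h3)
      · exact Or.inr ⟨-k, by rw [hk]; push_cast; ring⟩
    · rintro p q r ⟨h1, h2, h3⟩ ⟨g1, g2, g3⟩
      refine ⟨h1.trans g1, h2.trans g2, ?_⟩
      rcases h3 with h3 | ⟨k, hk⟩
      · exact Or.inl h3
      · rcases g3 with g3 | ⟨l, hl⟩
        · exact Or.inl (h2.trans g3)
        · exact Or.inr ⟨k + l, by rw [hl, hk]; push_cast; ring⟩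

/-- The conformally completed conical defect spacetime, including the defect worldline and the
conformal boundary. -/
def Spacetime : Type := Quotient eventSetoid

/-- The event with given coordinates. -/
def Coord.event (p : Coord) : Spacetime := Quotient.mk eventSetoid p

/-- A continuously differentiable future-directed causal curve, parametrized by `[0, 1]`, in a
chart. -/
structure IsCausalSegment (M : ℝ) (γ : ℝ → Coord) : Prop where
  t_contDiffOn : ContDiffOn ℝ 1 (fun s => (γ s).t) (Icc 0 1)
  σ_contDiffOn : ContDiffOn ℝ 1 (fun s => (γ s).σ) (Icc 0 1)
  φ_contDiffOn : ContDiffOn ℝ 1 (fun s => (γ s).φ) (Icc 0 1)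
  future : ∀ s ∈ Icc (0 : ℝ) 1, 0 ≤ derivWithin (fun s => (γ s).t) (Icc 0 1) s
  causal : ∀ s ∈ Icc (0 : ℝ) 1,
    conformalMetric M (γ s).σ
      (derivWithin (fun s => (γ s).t) (Icc 0 1) s)
      (derivWithin (fun s => (γ s).σ) (Icc 0 1) s)
      (derivWithin (fun s => (γ s).φ) (Icc 0 1) s) ≤ 0

/-- `p` and `q` are joined by one continuously differentiable causal segment. -/
def CausalStep (M : ℝ) (p q : Spacetime) : Prop :=
  ∃ γ : ℝ → Coord, IsCausalSegment M γ ∧ (γ 0).event = p ∧ (γ 1).event = q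

/-- The causal future of an event in the conformally completed spacetime: all events reached by a
piecewise continuously differentiable future-directed causal curve (which may pass through the
defect, where the angle may change between two segments). -/
def causalFuture (M : ℝ) (p : Spacetime) : Set Spacetime :=
  {q | Relation.ReflTransGen (CausalStep M) p q}

/-- The causal past of an event. -/
def causalPast (M : ℝ) (q : Spacetime) : Set Spacetime :=
  {p | Relation.ReflTransGen (CausalStep M) p q}

/-- The point `(t, φ)` of the conformal boundary. -/
def boundaryPoint (t φ : ℝ) : Spacetime :=
  Coord.event ⟨t, π / 2, φ, by positivity, le_rfl⟩

/-! ### The symmetric `n`-to-`n` setup -/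

/-- The allowed widths `x` and separations `θ`: the `n` input intervals of width `x`, with
neighbouring midpoints at distance `θ`, are pairwise separated on the circle. -/
def IsAdmissible (n : ℕ) (θ x : ℝ) : Prop :=
  0 < x ∧ x < θ ∧ ((n : ℝ) - 1) * θ + x < 2 * π

/-- The input points; the index `i = 0, …, n - 1` stands for `c_{i+1}`. -/
def inputPoint {n : ℕ} (θ x : ℝ) (i : Fin n) : Spacetime :=
  boundaryPoint (-x) ((i : ℝ) * θ)

/-- The index `m` of the central output point: `n = 2m - 1` or `n = 2m`. -/
def centralIndex (n : ℕ) : ℕ := (n + 1) / 2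

/-- The time of the output point `r_i`, `i = 1, …, n`. -/
def outputTime (n : ℕ) (θ : ℝ) (i : ℕ) : ℝ :=
  if i = centralIndex n then ((n : ℝ) - 1) / 2 * θ else π - θ / 2

/-- The angle of the output point `r_i`, `i = 1, …, n`. -/
def outputAngle (n : ℕ) (θ : ℝ) (i : ℕ) : ℝ :=
  if i = centralIndex n then ((n : ℝ) - 1) / 2 * θ
  else if Odd n then
    if i < centralIndex n then -π + ((i : ℝ) - 1 + (n : ℝ) / 2) * θ
    else π + ((i : ℝ) - 1 - (n : ℝ) / 2) * θ
  else
    if i < centralIndex n then -π + ((i : ℝ) + ((n : ℝ) - 1) / 2) * θ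
    else π + ((i : ℝ) - ((n : ℝ) + 1) / 2) * θ

/-- The output points; the index `i = 0, …, n - 1` stands for `r_{i+1}`. -/
def outputPoint {n : ℕ} (θ : ℝ) (i : Fin n) : Spacetime :=
  boundaryPoint (outputTime n θ (i + 1)) (outputAngle n θ (i + 1))

/-- The `2`-to-all bulk scattering region
`J⁺(c_j) ∩ J⁺(c_k) ∩ J⁻(r_1) ∩ ⋯ ∩ J⁻(r_n)`. -/
def scatteringRegion (M : ℝ) {n : ℕ} (θ x : ℝ) (j k : Fin n) : Set Spacetime :=
  causalFuture M (inputPoint θ x j) ∩ causalFuture M (inputPoint θ x k) ∩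
    ⋂ l : Fin n, causalPast M (outputPoint θ l)

/-- The `2`-to-all causal graph: `j` and `k` are joined when `c_j, c_k` can scatter to all the
output points. -/
def causalGraph (M : ℝ) (n : ℕ) (θ x : ℝ) : SimpleGraph (Fin n) where
  Adj j k := j ≠ k ∧ (scatteringRegion M θ x j k).Nonempty
  symm := ⟨by
    rintro j k ⟨hne, h⟩
    refine ⟨hne.symm, ?_⟩
    have hs : scatteringRegion M θ x k j = scatteringRegion M θ x j k := by
      unfold scatteringRegion
      rw [inter_comm (causalFuture M (inputPoint θ x k))]
    rw [hs]
    exact h⟩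
  loopless := ⟨fun _ h => h.1 rfl⟩

/-- Holographic `n`-to-`n` scattering is possible when the `2`-to-all causal graph is connected. -/
def HolographicScattering (M : ℝ) (n : ℕ) (θ x : ℝ) : Prop :=
  (causalGraph M n θ x).Connected

/-! ### RT candidates for the union of the input regions -/

/-- The angles of the `2n` endpoints of the input intervals, in counterclockwise order: the
endpoints number `2i` and `2i + 1` are the left and the right end of the interval centred at
`i θ`. -/
def endpointAngle {n : ℕ} (θ x : ℝ) (e : Fin (2 * n)) : ℝ :=
  ((e.val / 2 : ℕ) : ℝ) * θ + (if Even e.val then -(x / 2) else x / 2)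

/-- The endpoints on the closed boundary arc running counterclockwise from `g.1` to `g.2`. -/
def arcEndpoints {n : ℕ} (g : Fin (2 * n) × Fin (2 * n)) : Set (Fin (2 * n)) :=
  {e | if g.1 ≤ g.2 then g.1 ≤ e ∧ e ≤ g.2 else g.1 ≤ e ∨ e ≤ g.2}

/-- The opening angle of that arc. -/
def openingAngle {n : ℕ} (θ x : ℝ) (g : Fin (2 * n) × Fin (2 * n)) : ℝ :=
  if g.1 ≤ g.2 then endpointAngle θ x g.2 - endpointAngle θ x g.1
  else endpointAngle θ x g.2 - endpointAngle θ x g.1 + 2 * π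

/-- An RT candidate: pairwise non-crossing geodesics joining the endpoints of the input intervals
in pairs.  The pair `(a, b)` stands for the geodesic that can be deformed, without crossing the
defect, to the boundary arc running counterclockwise from `a` to `b`. -/
structure RTCandidate (n : ℕ) where
  geodesics : Finset (Fin (2 * n) × Fin (2 * n))
  ne : ∀ g ∈ geodesics, g.1 ≠ g.2
  matching : ∀ e : Fin (2 * n), ∃! g, g ∈ geodesics ∧ (e = g.1 ∨ e = g.2)
  noncrossing : ∀ g ∈ geodesics, ∀ h ∈ geodesics,
    arcEndpoints g ⊆ arcEndpoints h ∨ arcEndpoints h ⊆ arcEndpoints g ∨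
      Disjoint (arcEndpoints g) (arcEndpoints h)

open Classical in
/-- The length of an RT candidate, with a cutoff surface at `r = 1 / ε`: a geodesic of opening
angle `Δφ` exists for `Δφ < π / √|M|` and has length `2 log (2 / (√|M| ε) sin (√|M| Δφ / 2))`.
The value `⊤` means that the candidate does not exist. -/
def RTCandidate.length {n : ℕ} (M ε θ x : ℝ) (A : RTCandidate n) : WithTop ℝ :=
  if ∀ g ∈ A.geodesics, openingAngle θ x g < π / √(-M) then
    ((∑ g ∈ A.geodesics,
      2 * log (2 / (√(-M) * ε) * sin (√(-M) * openingAngle θ x g / 2)) : ℝ) : WithTop ℝ)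
  else ⊤

end

end ConicalDefect

namespace ConicalDefect

open Filter Topology

/-! Put `α = √(-M) < 1`. On the completed cone `dσ² + α² sin² σ dφ²` a causal curve is no longer
than `α` times its elapsed time, and the distance from a boundary point is 1-Lipschitz
(`dist_le_of_reflTransGen`). So for an event in `J⁺(c) ∩ J⁻(r)`, with time `T` from `c` to `r`, the
cone distances to `c` and `r` add up to at most `αT`. By `min_le_arccos_add_arccos` this sum is at
least the smaller of `π`, the shortcut through the defect, and `α` times the boundary path through
the event's angle. The bound on `M` gives `αT < π` for every pair used, so the event's angle obeys
the causality of the boundary circle (`circleDist_add_circleDist_le`).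

What remains is a statement about the circle. For an angle between two neighbouring inputs, the
output opposite to that gap forces both inputs `c_j`, `c_k` to be close; for an angle outside the
arc of inputs, the central output does. Since `x < θ`, one of any two inputs is too far
(`lt_circleDist_of_mem_gap`, `lt_circleDist_of_outside`). Hence the causal graph has no edges, and
no condition satisfied somewhere can imply scattering. -/

/-! ### Distances on the circle -/

/-- The distance of the angle `ψ` from `0` on the circle of circumference `2π`. -/
noncomputable def circleDist (ψ : ℝ) : ℝ := ‖(ψ : AddCircle (2 * π))‖

theorem circleDist_nonneg (ψ : ℝ) : 0 ≤ circleDist ψ := norm_nonneg _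

theorem circleDist_le_pi (ψ : ℝ) : circleDist ψ ≤ π := by
  have h := AddCircle.norm_le_half_period (2 * π) (x := (ψ : AddCircle (2 * π))) two_pi_pos.ne'
  rwa [abs_of_pos two_pi_pos, mul_div_cancel_left₀ _ (two_ne_zero' ℝ)] at h

theorem continuous_circleDist : Continuous circleDist :=
  continuous_norm.comp (AddCircle.continuous_mk' (2 * π))

theorem circleDist_add_int_mul (ψ : ℝ) (k : ℤ) :
    circleDist (ψ + 2 * π * k) = circleDist ψ := by
  have : ((ψ + 2 * π * k : ℝ) : AddCircle (2 * π)) = (ψ : AddCircle (2 * π)) := by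
    rw [AddCircle.coe_add, mul_comm (2 * π), ← zsmul_eq_mul, AddCircle.coe_zsmul,
      AddCircle.coe_period, smul_zero, add_zero]
  rw [circleDist, this, circleDist]

theorem exists_circleDist_eq_abs (ψ : ℝ) : ∃ k : ℤ, circleDist ψ = |ψ + 2 * π * k| := by
  refine ⟨-round ((2 * π)⁻¹ * ψ), ?_⟩
  rw [circleDist, AddCircle.norm_eq]
  push_cast
  ring_nf

theorem circleDist_eq_abs {ψ : ℝ} (h : |ψ| ≤ π) : circleDist ψ = |ψ| := by
  rw [circleDist, AddCircle.norm_coe_eq_abs_iff (2 * π) two_pi_pos.ne', abs_of_pos two_pi_pos]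
  linarith

theorem circleDist_le_abs (ψ : ℝ) : circleDist ψ ≤ |ψ| := by
  rcases le_total |ψ| π with h | h
  · exact (circleDist_eq_abs h).le
  · exact (circleDist_le_pi ψ).trans h

theorem circleDist_le_abs_add (ψ : ℝ) (k : ℤ) : circleDist ψ ≤ |ψ + 2 * π * k| := by
  rw [← circleDist_add_int_mul ψ k]
  exact circleDist_le_abs _

/-- A nonzero multiple of `2π` moves `ψ` by at least `2π`, so every other representative has
absolute value at least `2π - |ψ|`. -/
theorem le_circleDist {ψ a : ℝ} (h : a ≤ |ψ|) (h' : a ≤ 2 * π - |ψ|) : a ≤ circleDist ψ := by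
  obtain ⟨k, hk⟩ := exists_circleDist_eq_abs ψ
  rw [hk]
  rcases eq_or_ne k 0 with rfl | hk0
  · simpa using h
  · have h1 : (1 : ℝ) ≤ |(k : ℝ)| := by exact_mod_cast Int.one_le_abs hk0
    have h2 : |2 * π * (k : ℝ)| = 2 * π * |(k : ℝ)| := by
      rw [abs_mul, abs_of_pos two_pi_pos]
    have h3 : |2 * π * (k : ℝ)| ≤ |ψ + 2 * π * k| + |ψ| := by
      have := abs_sub (ψ + 2 * π * k) ψ
      simpa using this
    nlinarith [Real.pi_pos]

theorem lt_circleDist {ψ a : ℝ} (h : a < |ψ|) (h' : a < 2 * π - |ψ|) : a < circleDist ψ :=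
  (lt_min h h').trans_le (le_circleDist (min_le_left _ _) (min_le_right _ _))

/-! ### Distance from a boundary point -/

/-- The angular length of the geodesic on the cone `dσ² + sin² σ d(αψ)²` from the boundary point
at angle `0` to the point `(σ, ψ)`. -/
noncomputable def coneDist (α σ ψ : ℝ) : ℝ := arccos (sin σ * cos (α * circleDist ψ))

theorem cos_le_cos_circleDist {α ψ y : ℝ} (hα : 0 ≤ α) (h : circleDist ψ ≤ |y|)
    (hy : α * |y| ≤ π) : cos (α * y) ≤ cos (α * circleDist ψ) := by
  rw [← cos_abs (α * y), abs_mul, abs_of_nonneg hα]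
  exact cos_le_cos_of_nonneg_of_le_pi (mul_nonneg hα (circleDist_nonneg _)) hy
    (mul_le_mul_of_nonneg_left h hα)

/-- The function `h = sin σ cos (αy)` is a linear coordinate on the unit sphere, so its gradient has
squared norm `1 - h²`. The factor `k < 1` keeps `arccos (k h)` differentiable, and `k² (1 - h²) ≤ 1
- k² h²` keeps its slope at most 1. -/
theorem speed_bound {α k σ y σ' y' τ' : ℝ} (hk0 : 0 ≤ k) (hk1 : k < 1) (hτ : 0 ≤ τ')
    (hc : σ' ^ 2 + α ^ 2 * sin σ ^ 2 * y' ^ 2 ≤ τ' ^ 2) :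
    -(1 / √(1 - (k * (sin σ * cos (α * y))) ^ 2)) *
      (k * (cos σ * σ' * cos (α * y) + sin σ * (-sin (α * y) * (α * y')))) ≤ τ' := by
  set h := sin σ * cos (α * y) with hh
  have e1 := sin_sq_add_cos_sq σ
  have e2 := sin_sq_add_cos_sq (α * y)
  have hle : h ^ 2 ≤ 1 := by
    rw [hh, mul_pow]
    nlinarith [sq_nonneg (cos σ), sq_nonneg (sin (α * y)), sq_nonneg (sin σ),
      sq_nonneg (cos (α * y))]
  have hk2 : k ^ 2 < 1 := by nlinarith
  have hpos : 0 < 1 - (k * h) ^ 2 := by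
    rw [mul_pow]; nlinarith [sq_nonneg h, sq_nonneg k]
  have hs := Real.sqrt_pos.mpr hpos
  have hsq := Real.sq_sqrt hpos.le
  set D := cos σ * σ' * cos (α * y) + sin σ * (-sin (α * y) * (α * y')) with hD
  have hcs : D ^ 2 ≤ (1 - h ^ 2) * τ' ^ 2 := by
    -- The defect in the Cauchy–Schwarz inequality, as a perfect square.
    have key : (1 - h ^ 2) * (σ' ^ 2 + α ^ 2 * sin σ ^ 2 * y' ^ 2) - D ^ 2 =
        (cos σ * cos (α * y) * (sin σ * (α * y')) + sin (α * y) * σ') ^ 2 := by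
      rw [hD, hh]
      have e3 : cos σ ^ 2 = 1 - sin σ ^ 2 := by linarith
      have e4 : sin (α * y) ^ 2 = 1 - cos (α * y) ^ 2 := by linarith
      ring_nf
      simp only [e3, e4]
      ring
    have := mul_le_mul_of_nonneg_left hc (sub_nonneg.mpr hle)
    nlinarith [sq_nonneg (cos σ * cos (α * y) * (sin σ * (α * y')) + sin (α * y) * σ')]
  have hfin : -(k * D) ≤ τ' * √(1 - (k * h) ^ 2) := by
    refine le_of_abs_le (abs_le_of_sq_le_sq ?_ (mul_nonneg hτ hs.le))
    rw [mul_pow, hsq, neg_sq, mul_pow, mul_pow]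
    have a1 : k ^ 2 * D ^ 2 ≤ k ^ 2 * ((1 - h ^ 2) * τ' ^ 2) :=
      mul_le_mul_of_nonneg_left hcs (sq_nonneg k)
    nlinarith [mul_nonneg (sub_nonneg.mpr hk2.le) (sq_nonneg τ')]
  calc _ = -(k * D) / √(1 - (k * h) ^ 2) := by ring
    _ ≤ τ' := by rwa [div_le_iff₀ hs]

/-- With `k < 1` the singularities of `arccos` at `±1` are gone. The corner of `circleDist` at the
antipode remains: there a smooth branch of the angle gives a function `g ≥ f` touching `f` at `s`,
and bounding right slopes of `f` by those of `g` suffices. -/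
theorem regularized_coneDist_le {α k : ℝ} (hα0 : 0 < α) (hα1 : α < 1) (hk0 : 0 ≤ k) (hk1 : k < 1)
    {σ ψ τ σ' ψ' τ' : ℝ → ℝ}
    (hσ : ∀ s ∈ Icc (0 : ℝ) 1, HasDerivWithinAt σ (σ' s) (Icc 0 1) s)
    (hψ : ∀ s ∈ Icc (0 : ℝ) 1, HasDerivWithinAt ψ (ψ' s) (Icc 0 1) s)
    (hτ : ∀ s ∈ Icc (0 : ℝ) 1, HasDerivWithinAt τ (τ' s) (Icc 0 1) s)
    (hτ0 : ∀ s ∈ Icc (0 : ℝ) 1, 0 ≤ τ' s)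
    (hc : ∀ s ∈ Icc (0 : ℝ) 1, σ' s ^ 2 + α ^ 2 * sin (σ s) ^ 2 * ψ' s ^ 2 ≤ τ' s ^ 2)
    (hσ0 : ∀ s ∈ Icc (0 : ℝ) 1, 0 ≤ sin (σ s)) :
    arccos (k * (sin (σ 1) * cos (α * circleDist (ψ 1)))) ≤
      arccos (k * (sin (σ 0) * cos (α * circleDist (ψ 0)))) + (τ 1 - τ 0) := by
  have cσ : ContinuousOn σ (Icc 0 1) := fun s hs => (hσ s hs).continuousWithinAt
  have cψ : ContinuousOn ψ (Icc 0 1) := fun s hs => (hψ s hs).continuousWithinAt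
  have cτ : ContinuousOn τ (Icc 0 1) := fun s hs => (hτ s hs).continuousWithinAt
  set f : ℝ → ℝ := fun s => arccos (k * (sin (σ s) * cos (α * circleDist (ψ s)))) with hf
  have cf : ContinuousOn f (Icc 0 1) :=
    continuous_arccos.comp_continuousOn (continuousOn_const.mul
      ((continuous_sin.comp_continuousOn cσ).mul (continuous_cos.comp_continuousOn
        (continuousOn_const.mul (continuous_circleDist.comp_continuousOn cψ)))))
  refine image_le_of_liminf_slope_right_le_deriv_boundary (f := f) (a := 0) (b := 1)
    (B := fun s => f 0 + (τ s - τ 0)) (B' := τ') cf (by simp)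
    (continuousOn_const.add (cτ.sub continuousOn_const)) ?_ ?_ (right_mem_Icc.mpr zero_le_one)
  · intro s hs
    have := (hτ s (Ico_subset_Icc_self hs)).mono_of_mem_nhdsWithin (Icc_mem_nhdsGE_of_mem hs)
    exact (this.sub_const (τ 0)).const_add (f 0)
  · intro s hs r hr
    have hs' := Ico_subset_Icc_self hs
    obtain ⟨m, hm⟩ := exists_circleDist_eq_abs (ψ s)
    set y : ℝ → ℝ := fun z => ψ z + 2 * π * m with hy
    set g : ℝ → ℝ := fun z => arccos (k * (sin (σ z) * cos (α * y z))) with hg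
    have dσ := (hσ s hs').mono_of_mem_nhdsWithin (Icc_mem_nhdsGE_of_mem hs)
    have dy : HasDerivWithinAt y (ψ' s) (Ici s) s :=
      ((hψ s hs').mono_of_mem_nhdsWithin (Icc_mem_nhdsGE_of_mem hs)).add_const (2 * π * m)
    have habs : |k * (sin (σ s) * cos (α * y s))| < 1 := by
      rw [abs_mul, abs_mul, abs_of_nonneg hk0]
      have := mul_le_one₀ (abs_sin_le_one (σ s)) (abs_nonneg _) (abs_cos_le_one (α * y s))
      nlinarith [mul_nonneg (abs_nonneg (sin (σ s))) (abs_nonneg (cos (α * y s)))]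
    have dg := (hasDerivAt_arccos (abs_lt.mp habs).1.ne' (abs_lt.mp habs).2.ne).comp_hasDerivWithinAt
      s ((dσ.sin.mul (dy.const_mul α).cos).const_mul k)
    have hslope : ∀ᶠ z in 𝓝[>] s, slope g s z < r :=
      (dg.mono Ioi_subset_Ici_self).limsup_slope_le' self_notMem_Ioi
        ((speed_bound hk0 hk1 (hτ0 s hs') (hc s hs')).trans_lt hr)
    -- Here `α < 1` enters: `|y s| ≤ π < π / α`, so near `s` the cosine is still monotone on the
    -- chosen branch.
    have hnear : ∀ᶠ z in 𝓝[>] s, |y z| < π / α := by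
      have : Tendsto (fun z => |y z|) (𝓝[>] s) (𝓝 |y s|) :=
        (dy.continuousWithinAt.mono Ioi_subset_Ici_self).abs
      refine this.eventually_lt_const ?_
      rw [← hm]
      exact (circleDist_le_pi _).trans_lt ((lt_div_iff₀ hα0).mpr (by nlinarith [Real.pi_pos]))
    have hmem : ∀ᶠ z in 𝓝[>] s, z ∈ Icc (0 : ℝ) 1 :=
      nhdsWithin_mono s Ioi_subset_Ici_self (Icc_mem_nhdsGE_of_mem hs)
    have hgs : f s = g s := by
      simp only [hf, hg]
      rw [hm, ← cos_abs (α * y s), abs_mul, abs_of_pos hα0]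
    refine Eventually.frequently ?_
    filter_upwards [hslope, hnear, hmem, self_mem_nhdsWithin] with z h1 h2 h3 h4
    refine lt_of_le_of_lt ?_ h1
    rw [slope_def_field, slope_def_field, hgs]
    have hz : (0 : ℝ) ≤ z - s := (sub_pos.mpr h4).le
    refine div_le_div_of_nonneg_right (sub_le_sub_right ?_ _) hz
    apply arccos_le_arccos
    refine mul_le_mul_of_nonneg_left (mul_le_mul_of_nonneg_left ?_ (hσ0 z h3)) hk0
    refine cos_le_cos_circleDist hα0.le (circleDist_le_abs_add _ m) ?_
    rw [mul_comm]
    exact ((lt_div_iff₀ hα0).mp h2).le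

theorem coneDist_le_of_curve {α : ℝ} (hα0 : 0 < α) (hα1 : α < 1) {σ ψ τ σ' ψ' τ' : ℝ → ℝ}
    (hσ : ∀ s ∈ Icc (0 : ℝ) 1, HasDerivWithinAt σ (σ' s) (Icc 0 1) s)
    (hψ : ∀ s ∈ Icc (0 : ℝ) 1, HasDerivWithinAt ψ (ψ' s) (Icc 0 1) s)
    (hτ : ∀ s ∈ Icc (0 : ℝ) 1, HasDerivWithinAt τ (τ' s) (Icc 0 1) s)
    (hτ0 : ∀ s ∈ Icc (0 : ℝ) 1, 0 ≤ τ' s)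
    (hc : ∀ s ∈ Icc (0 : ℝ) 1, σ' s ^ 2 + α ^ 2 * sin (σ s) ^ 2 * ψ' s ^ 2 ≤ τ' s ^ 2)
    (hσ0 : ∀ s ∈ Icc (0 : ℝ) 1, 0 ≤ sin (σ s)) :
    coneDist α (σ 1) (ψ 1) ≤ coneDist α (σ 0) (ψ 0) + (τ 1 - τ 0) := by
  have lim : ∀ h : ℝ, Tendsto (fun k : ℝ => arccos (k * h)) (𝓝[<] 1) (𝓝 (arccos h)) := by
    intro h
    have : Continuous fun k : ℝ => arccos (k * h) := by fun_prop
    simpa using (this.tendsto 1).mono_left nhdsWithin_le_nhds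
  refine le_of_tendsto_of_tendsto (lim _) ((lim _).add_const _) ?_
  filter_upwards [Ico_mem_nhdsLT (zero_lt_one' ℝ)] with k hk
  exact regularized_coneDist_le hα0 hα1 hk.1 hk.2 hσ hψ hτ hτ0 hc hσ0

/-- The boundary circle is geodesic up to the shortcut of length `π` through the defect. -/
theorem min_le_arccos_add_arccos {a b s : ℝ} (ha : a ≤ π) (hb : b ≤ π) (hs0 : 0 ≤ s)
    (hs1 : s ≤ 1) :
    min (a + b) π ≤ arccos (s * cos a) + arccos (s * cos b) := by
  rcases le_total (a + b) π with hab | hab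
  · rw [min_eq_left hab]
    by_contra! hlt
    have hA := arccos_nonneg (s * cos a)
    have hB := arccos_nonneg (s * cos b)
    have hcos := cos_lt_cos_of_nonneg_of_le_pi (add_nonneg hA hB) hab hlt
    have bd : ∀ c : ℝ, -1 ≤ s * cos c ∧ s * cos c ≤ 1 := fun c =>
      abs_le.mp (by
        rw [abs_mul, abs_of_nonneg hs0]
        exact mul_le_one₀ hs1 (abs_nonneg _) (abs_cos_le_one c))
    rw [cos_add, cos_add, cos_arccos (bd a).1 (bd a).2, cos_arccos (bd b).1 (bd b).2,
      sin_arccos, sin_arccos, ← Real.sqrt_mul (by nlinarith [bd a])] at hcos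
    have hw : 0 ≤ 1 - s ^ 2 := by nlinarith
    -- This amounts to `cos (A + B) ≤ cos (a + b)` for the two arccosines `A`, `B`, contradicting
    -- `hcos`.
    have key : sin a * sin b - (1 - s ^ 2) * (cos a * cos b) ≤
        √((1 - (s * cos a) ^ 2) * (1 - (s * cos b) ^ 2)) := by
      apply Real.le_sqrt_of_sq_le
      have : (1 - (s * cos a) ^ 2) * (1 - (s * cos b) ^ 2) -
          (sin a * sin b - (1 - s ^ 2) * (cos a * cos b)) ^ 2 =
          (1 - s ^ 2) * (sin a * cos b + cos a * sin b) ^ 2 := by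
        have e1 : sin a ^ 2 = 1 - cos a ^ 2 := by linarith [sin_sq_add_cos_sq a]
        have e2 : sin b ^ 2 = 1 - cos b ^ 2 := by linarith [sin_sq_add_cos_sq b]
        ring_nf
        simp only [e1, e2]
        ring
      nlinarith [mul_nonneg hw (sq_nonneg (sin a * cos b + cos a * sin b))]
    nlinarith
  · rw [min_eq_right hab]
    have h1 : arccos (-(s * cos b)) ≤ arccos (s * cos a) := by
      apply arccos_le_arccos
      rw [← mul_neg, ← cos_pi_sub]
      exact mul_le_mul_of_nonneg_left
        (cos_le_cos_of_nonneg_of_le_pi (by linarith) ha (by linarith)) hs0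
    rw [arccos_neg] at h1
    linarith

/-! ### Causal curves in the completed spacetime -/

/-- The time coordinate of an event. -/
def Spacetime.time : Spacetime → ℝ :=
  Quotient.lift Coord.t fun _ _ h => h.1

/-- The distance on the cone between the boundary point at angle `β` and an event. -/
noncomputable def Spacetime.dist (α β : ℝ) : Spacetime → ℝ :=
  Quotient.lift (fun p : Coord => coneDist α p.σ (p.φ - β)) (by
    rintro p q ⟨-, h2, h3 | ⟨k, hk⟩⟩
    · simp [coneDist, ← h2, h3]
    · simp only [coneDist]
      rw [← h2, hk, show p.φ + 2 * π * k - β = p.φ - β + 2 * π * k by ring,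
        circleDist_add_int_mul])

theorem Coord.sin_nonneg (p : Coord) : 0 ≤ sin p.σ :=
  sin_nonneg_of_nonneg_of_le_pi p.σ_nonneg (by linarith [p.σ_le, Real.pi_pos])

theorem CausalStep.dist_le {M : ℝ} (hM : -1 < M) (hM0 : M < 0) (β : ℝ) {p q : Spacetime}
    (h : CausalStep M p q) :
    q.dist (√(-M)) β ≤ p.dist (√(-M)) β + √(-M) * (q.time - p.time) ∧
      p.dist (√(-M)) β ≤ q.dist (√(-M)) β + √(-M) * (q.time - p.time) := by
  obtain ⟨γ, hγ, rfl, rfl⟩ := h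
  set α := √(-M) with hα
  have hα0 : 0 < α := Real.sqrt_pos.mpr (by linarith)
  have hα1 : α < 1 := (Real.sqrt_lt' one_pos).mpr (by linarith)
  have hαM : α ^ 2 = -M := Real.sq_sqrt (by linarith)
  have dt := fun s hs => (hγ.t_contDiffOn.differentiableOn one_ne_zero s hs).hasDerivWithinAt
  have dσ := fun s hs => (hγ.σ_contDiffOn.differentiableOn one_ne_zero s hs).hasDerivWithinAt
  have dφ := fun s hs => (hγ.φ_contDiffOn.differentiableOn one_ne_zero s hs).hasDerivWithinAt
  set t' := fun s => derivWithin (fun s => (γ s).t) (Icc 0 1) s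
  set σ' := fun s => derivWithin (fun s => (γ s).σ) (Icc 0 1) s
  set φ' := fun s => derivWithin (fun s => (γ s).φ) (Icc 0 1) s
  have hcausal : ∀ s ∈ Icc (0 : ℝ) 1,
      σ' s ^ 2 + α ^ 2 * sin (γ s).σ ^ 2 * φ' s ^ 2 ≤ (α * t' s) ^ 2 := by
    intro s hs
    have := hγ.causal s hs
    rw [conformalMetric] at this
    rw [mul_pow, hαM]
    linarith
  constructor
  · have := coneDist_le_of_curve (σ := fun s => (γ s).σ) (ψ := fun s => (γ s).φ - β)
      (τ := fun s => α * (γ s).t) hα0 hα1 dσ (fun s hs => (dφ s hs).sub_const β)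
      (fun s hs => (dt s hs).const_mul α) (fun s hs => mul_nonneg hα0.le (hγ.future s hs))
      hcausal (fun s _ => (γ s).sin_nonneg)
    rw [← mul_sub] at this
    exact this
  -- Reversing the curve and negating time preserves the hypotheses and exchanges the endpoints.
  · have hmaps : MapsTo (fun s : ℝ => 1 - s) (Icc 0 1) (Icc 0 1) := fun s hs =>
      ⟨by linarith [hs.2], by linarith [hs.1]⟩
    have rev : ∀ {f f' : ℝ → ℝ}, (∀ s ∈ Icc (0 : ℝ) 1, HasDerivWithinAt f (f' s) (Icc 0 1) s) →
        ∀ s ∈ Icc (0 : ℝ) 1,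
          HasDerivWithinAt (fun s => f (1 - s)) (-f' (1 - s)) (Icc 0 1) s := by
      intro f f' hf s hs
      have h1 : HasDerivWithinAt (fun s : ℝ => 1 - s) (-1) (Icc 0 1) s :=
        (hasDerivWithinAt_id s _).const_sub 1
      simpa using! (hf (1 - s) (hmaps hs)).comp s h1 hmaps
    have := coneDist_le_of_curve (σ := fun s => (γ (1 - s)).σ)
      (ψ := fun s => (γ (1 - s)).φ - β) (τ := fun s => -(α * (γ (1 - s)).t))
      (τ' := fun s => α * t' (1 - s)) hα0 hα1 (rev dσ)
      (fun s hs => (rev dφ s hs).sub_const β)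
      (fun s hs => by simpa using! ((rev dt s hs).const_mul α).neg)
      (fun s hs => mul_nonneg hα0.le (hγ.future _ (hmaps hs)))
      (fun s hs => by rw [neg_sq, neg_sq]; exact hcausal _ (hmaps hs))
      (fun s _ => (γ (1 - s)).sin_nonneg)
    simp only [sub_self, sub_zero] at this
    rw [show -(α * (γ 0).t) - -(α * (γ 1).t) = α * ((γ 1).t - (γ 0).t) by ring] at this
    exact this

theorem dist_le_of_reflTransGen {M : ℝ} (hM : -1 < M) (hM0 : M < 0) (β : ℝ) {p q : Spacetime}
    (h : Relation.ReflTransGen (CausalStep M) p q) :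
    q.dist (√(-M)) β ≤ p.dist (√(-M)) β + √(-M) * (q.time - p.time) ∧
      p.dist (√(-M)) β ≤ q.dist (√(-M)) β + √(-M) * (q.time - p.time) := by
  induction h with
  | refl => simp
  | tail _ hbc ih =>
    have := hbc.dist_le hM hM0 β
    constructor <;> linarith [this.1, this.2, ih.1, ih.2]

theorem time_boundaryPoint (t φ : ℝ) : (boundaryPoint t φ).time = t := rfl

theorem dist_boundaryPoint_self (α t φ : ℝ) : (boundaryPoint t φ).dist α φ = 0 := by
  change coneDist α (π / 2) (φ - φ) = 0
  simp [coneDist, circleDist]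

/-- A causal curve between boundary points that is too fast to pass through the defect is no
faster than a boundary curve through the same angle. -/
theorem circleDist_add_circleDist_le {M : ℝ} (hM : -1 < M) (hM0 : M < 0) {t₁ φ₁ t₂ φ₂ : ℝ}
    (p : Coord) (h₁ : p.event ∈ causalFuture M (boundaryPoint t₁ φ₁))
    (h₂ : p.event ∈ causalPast M (boundaryPoint t₂ φ₂)) (ht : √(-M) * (t₂ - t₁) < π) :
    circleDist (p.φ - φ₁) + circleDist (p.φ - φ₂) ≤ t₂ - t₁ := by
  have hα0 : 0 < √(-M) := Real.sqrt_pos.mpr (by linarith)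
  have hα1 : √(-M) < 1 := (Real.sqrt_lt' one_pos).mpr (by linarith)
  have g₁ := (dist_le_of_reflTransGen hM hM0 φ₁ h₁).1
  have g₂ := (dist_le_of_reflTransGen hM hM0 φ₂ h₂).2
  rw [dist_boundaryPoint_self, time_boundaryPoint] at g₁ g₂
  have bd : ∀ ψ, √(-M) * circleDist ψ ≤ π := fun ψ => by
    nlinarith [circleDist_le_pi ψ, circleDist_nonneg ψ]
  have key := min_le_arccos_add_arccos (bd (p.φ - φ₁)) (bd (p.φ - φ₂)) p.sin_nonneg
    (sin_le_one p.σ)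
  change coneDist (√(-M)) p.σ (p.φ - φ₁) ≤ _ at g₁
  change coneDist (√(-M)) p.σ (p.φ - φ₂) ≤ _ at g₂
  rw [coneDist] at g₁ g₂
  have hmin : min (√(-M) * circleDist (p.φ - φ₁) + √(-M) * circleDist (p.φ - φ₂)) π ≤
      √(-M) * (t₂ - t₁) := by linarith
  rcases min_le_iff.mp hmin with h | h
  · rw [← mul_add] at h
    exact le_of_mul_le_mul_left h hα0
  · exact absurd ht h.not_gt

/-! ### The symmetric configuration -/

/-- The bound on `M` says `α < n / (n + 1)`. The time `(n + 1)π / n` is the limit, as `x` and `θ`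
tend to `2π / n`, of the time from the inputs to either kind of output. -/
theorem sqrt_neg_mul_lt {n : ℕ} {M T : ℝ} (hM : -((n : ℝ) ^ 2 / ((n : ℝ) + 1) ^ 2) < M)
    (hT : n * T < (n + 1) * π) (hn : 0 < n) : √(-M) * T < π := by
  have hn' : (0 : ℝ) < n := by exact_mod_cast hn
  have h1 : √(-M) < n / (n + 1) := by
    rw [Real.sqrt_lt' (by positivity), div_pow]
    linarith
  rcases le_or_gt T 0 with hT0 | hT0
  · exact (mul_nonpos_of_nonneg_of_nonpos (Real.sqrt_nonneg _) hT0).trans_lt Real.pi_pos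
  · calc √(-M) * T < n / (n + 1) * T := mul_lt_mul_of_pos_right h1 hT0
      _ = n * T / (n + 1) := by ring
      _ < π := by rw [div_lt_iff₀ (by positivity)]; linarith

/-- Opposite to the middle of each gap between neighbouring inputs there is an output point. -/
theorem exists_output_opposite {n : ℕ} (hn : 2 ≤ n) (θ : ℝ) {i : ℕ} (hi : i + 2 ≤ n) :
    ∃ l : Fin n, outputTime n θ (l + 1) = π - θ / 2 ∧
      (outputAngle n θ (l + 1) = (i + 1 / 2) * θ + π ∨
        outputAngle n θ (l + 1) = (i + 1 / 2) * θ - π) := by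
  unfold outputTime outputAngle centralIndex
  rcases Nat.even_or_odd' n with ⟨m, hm | hm⟩
  · have hodd : ¬ Odd n := by simp [hm]
    have hc : (n + 1) / 2 = m := by omega
    have hnm : (n : ℝ) = 2 * m := by exact_mod_cast hm
    -- The opposite output is half a turn further in the cyclic order; the two cases are without and
    -- with wrapping past the last index.
    rcases lt_or_ge i m with h | h
    · refine ⟨⟨i + m, by omega⟩, ?_, Or.inl ?_⟩
      · rw [if_neg (by simp only; omega)]
      · rw [if_neg (by simp only; omega), if_neg hodd, if_neg (by simp only; omega), hnm]
        push_cast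
        ring
    · obtain ⟨d, rfl⟩ := Nat.exists_eq_add_of_le h
      refine ⟨⟨d, by omega⟩, ?_, Or.inr ?_⟩
      · rw [if_neg (by simp only; omega)]
      · rw [if_neg (by simp only; omega), if_neg hodd, if_pos (by simp only; omega), hnm]
        push_cast
        ring
  · have hodd : Odd n := ⟨m, hm⟩
    have hc : (n + 1) / 2 = m + 1 := by omega
    have hnm : (n : ℝ) = 2 * m + 1 := by exact_mod_cast hm
    rcases lt_or_ge i m with h | h
    · refine ⟨⟨i + m + 1, by omega⟩, ?_, Or.inl ?_⟩
      · rw [if_neg (by simp only; omega)]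
      · rw [if_neg (by simp only; omega), if_pos hodd, if_neg (by simp only; omega), hnm]
        push_cast
        ring
    · obtain ⟨d, rfl⟩ := Nat.exists_eq_add_of_le h
      refine ⟨⟨d, by omega⟩, ?_, Or.inr ?_⟩
      · rw [if_neg (by simp only; omega)]
      · rw [if_neg (by simp only; omega), if_pos hodd, if_pos (by simp only; omega), hnm]
        push_cast
        ring

theorem exists_output_central {n : ℕ} (hn : 2 ≤ n) (θ : ℝ) :
    ∃ l : Fin n, outputTime n θ (l + 1) = (n - 1) / 2 * θ ∧
      outputAngle n θ (l + 1) = (n - 1) / 2 * θ := by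
  have h : (n + 1) / 2 - 1 + 1 = centralIndex n := by
    unfold centralIndex
    omega
  refine ⟨⟨(n + 1) / 2 - 1, by omega⟩, ?_, ?_⟩
  · simp [outputTime, h]
  · simp [outputAngle, h]

/-- From a point between two neighbouring inputs, one of any two inputs is at least as far as the
farther neighbour. -/
theorem lt_circleDist_of_mem_gap {n i j k : ℕ} {θ x u : ℝ} (hx0 : 0 < x) (hx : x < θ)
    (hadm : ((n : ℝ) - 1) * θ + x < 2 * π) (hi : i + 2 ≤ n) (hu : |u| ≤ θ / 2)
    (hjk : j < k) (hk : k < n) :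
    x - θ / 2 + |u| < circleDist ((i + 1 / 2) * θ + u - j * θ) ∨
      x - θ / 2 + |u| < circleDist ((i + 1 / 2) * θ + u - k * θ) := by
  have hθ : 0 < θ := hx0.trans hx
  have hi' : (i : ℝ) + 2 ≤ n := by exact_mod_cast hi
  have hi0 : (0 : ℝ) ≤ i := Nat.cast_nonneg _
  have hu' := abs_le.mp hu
  -- The way around the back is longer than `x`, because the inputs span only `(n - 1)θ < 2π - x`.
  have wrap : ∀ c : ℕ, c < n →
      x - θ / 2 + |u| < 2 * π - |(i + 1 / 2) * θ + u - c * θ| := by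
    intro c hc
    have hc0 : (0 : ℝ) ≤ c := Nat.cast_nonneg _
    have hcn : (c : ℝ) + 1 ≤ n := by exact_mod_cast hc
    have : |(i + 1 / 2) * θ + u - c * θ| ≤ (n - 1) * θ := by
      rw [abs_le]
      constructor <;> nlinarith
    linarith
  have far : ∀ c : ℕ, c < n → θ / 2 + |u| ≤ |(i + 1 / 2) * θ + u - c * θ| →
      x - θ / 2 + |u| < circleDist ((i + 1 / 2) * θ + u - c * θ) := fun c hc h =>
    lt_circleDist (by linarith) (wrap c hc)
  rcases le_total 0 u with h0 | h0
  · rw [abs_of_nonneg h0] at far ⊢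
    rcases le_or_gt j i with h | h
    · have h' : (j : ℝ) ≤ i := by exact_mod_cast h
      refine Or.inl (far j (hjk.trans hk) (le_trans ?_ (le_abs_self _)))
      nlinarith
    · have h' : (i : ℝ) + 2 ≤ k := by exact_mod_cast (show i + 2 ≤ k by omega)
      refine Or.inr (far k hk (le_trans ?_ (neg_le_abs _)))
      nlinarith
  · rw [abs_of_nonpos h0] at far ⊢
    rcases le_or_gt k i with h | h
    · have h' : (j : ℝ) + 1 ≤ i := by exact_mod_cast (show j + 1 ≤ i by omega)
      refine Or.inl (far j (hjk.trans hk) (le_trans ?_ (le_abs_self _)))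
      nlinarith
    · have h' : (i : ℝ) + 1 ≤ k := by exact_mod_cast h
      refine Or.inr (far k hk (le_trans ?_ (neg_le_abs _)))
      nlinarith

/-- From a point outside the arc spanned by the inputs, one of any two inputs is not the nearest
one. -/
theorem lt_circleDist_of_outside {n j k : ℕ} {θ x v : ℝ} (hx0 : 0 < x) (hx : x < θ)
    (hadm : ((n : ℝ) - 1) * θ + x < 2 * π) (hv : (n - 1) / 2 * θ ≤ |v|)
    (hjk : j < k) (hk : k < n) :
    (n - 1) / 2 * θ + x - |v| < circleDist ((n - 1) / 2 * θ + v - j * θ) ∨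
      (n - 1) / 2 * θ + x - |v| < circleDist ((n - 1) / 2 * θ + v - k * θ) := by
  have hθ : 0 < θ := hx0.trans hx
  have hj0 : (0 : ℝ) ≤ j := Nat.cast_nonneg _
  have hjk' : (j : ℝ) + 1 ≤ k := by exact_mod_cast hjk
  have hk' : (k : ℝ) + 1 ≤ n := by exact_mod_cast hk
  rcases le_total 0 v with h0 | h0
  · rw [abs_of_nonneg h0] at hv ⊢
    have hy : 0 ≤ (n - 1) / 2 * θ + v - j * θ := by nlinarith
    -- Beyond the last input, `j` is not the nearest one since `j < k`, which gains an extra `θ >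
    -- x`.
    refine Or.inl (lt_circleDist ?_ ?_) <;> rw [abs_of_nonneg hy] <;> nlinarith
  · rw [abs_of_nonpos h0] at hv ⊢
    have hy : (n - 1) / 2 * θ + v - k * θ ≤ 0 := by nlinarith
    refine Or.inr (lt_circleDist ?_ ?_) <;> rw [abs_of_nonpos hy] <;> nlinarith

theorem exists_gap {n : ℕ} {θ φ : ℝ} (hn : 2 ≤ n) (hθ : 0 < θ) (h0 : 0 ≤ φ)
    (h1 : φ ≤ (n - 1) * θ) :
    ∃ i : ℕ, i + 2 ≤ n ∧ |φ - (i + 1 / 2) * θ| ≤ θ / 2 := by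
  -- At the right end the floor would be `n - 1`, which labels no gap.
  rcases h1.eq_or_lt with rfl | h1
  · refine ⟨n - 2, by omega, ?_⟩
    rw [Nat.cast_sub hn, abs_le]
    push_cast
    constructor <;> linarith
  · refine ⟨⌊φ / θ⌋₊, ?_, ?_⟩
    · have h : ⌊φ / θ⌋₊ < n - 1 := by
        rw [Nat.floor_lt (by positivity), div_lt_iff₀ hθ, Nat.cast_sub (by omega)]
        exact_mod_cast h1
      omega
    · have a1 := (le_div_iff₀ hθ).mp (Nat.floor_le (show 0 ≤ φ / θ by positivity))
      have a2 := (div_lt_iff₀ hθ).mp (Nat.lt_floor_add_one (φ / θ))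
      rw [abs_le]
      constructor <;> linarith

/-! ### Emptiness of the scattering regions -/

theorem neg_one_lt_of_bound {n : ℕ} {M : ℝ} (hM : -((n : ℝ) ^ 2 / ((n : ℝ) + 1) ^ 2) < M) :
    -1 < M := by
  have h0 : (0 : ℝ) ≤ n := Nat.cast_nonneg _
  have : (n : ℝ) ^ 2 / ((n : ℝ) + 1) ^ 2 ≤ 1 := by
    rw [div_le_one (by positivity)]
    nlinarith
  linarith

theorem scatteringRegion_eq_empty_of_lt {n : ℕ} (hn : 2 ≤ n) {M θ x : ℝ}
    (hM : -((n : ℝ) ^ 2 / ((n : ℝ) + 1) ^ 2) < M) (hM0 : M < 0) (h : IsAdmissible n θ x)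
    {j k : Fin n} (hjk : j < k) : scatteringRegion M θ x j k = ∅ := by
  obtain ⟨hx0, hx, hadm⟩ := h
  have hθ : 0 < θ := hx0.trans hx
  have hn' : (2 : ℝ) ≤ n := by exact_mod_cast hn
  have hM1 := neg_one_lt_of_bound hM
  rw [eq_empty_iff_forall_notMem]
  rintro e ⟨⟨hj, hk⟩, hl⟩
  induction e using Quotient.inductionOn with
  | h p =>
  change p.event ∈ _ at hj
  change p.event ∈ _ at hk
  have hl' : ∀ l : Fin n, p.event ∈ causalPast M (outputPoint θ l) := mem_iInter.mp hl
  -- Choose the representative of the angle nearest to the middle of the arc of inputs.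
  obtain ⟨w, hw⟩ := exists_circleDist_eq_abs (p.φ - (n - 1) / 2 * θ)
  set φ := p.φ + 2 * π * w with hφ
  have shift : ∀ β, circleDist (p.φ - β) = circleDist (φ - β) := fun β => by
    rw [← circleDist_add_int_mul _ w, hφ]
    ring_nf
  have bound : ∀ l : Fin n, n * (outputTime n θ (l + 1) + x) < (n + 1) * π →
      ∀ c : Fin n, (c = j ∨ c = k) →
      circleDist (φ - c * θ) + circleDist (φ - outputAngle n θ (l + 1)) ≤
        outputTime n θ (l + 1) + x := by
    intro l hT c hc
    have hc' : p.event ∈ causalFuture M (inputPoint θ x c) := by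
      rcases hc with rfl | rfl <;> assumption
    have := circleDist_add_circleDist_le hM1 hM0 p hc' (hl' l)
      (by rw [sub_neg_eq_add]; exact sqrt_neg_mul_lt hM hT (by omega))
    rwa [shift, shift, sub_neg_eq_add] at this
  rcases le_or_gt |φ - (n - 1) / 2 * θ| ((n - 1) / 2 * θ) with hv | hv
  · obtain ⟨i, hi, hu⟩ := exists_gap (φ := φ) hn hθ (by linarith [(abs_le.mp hv).1])
      (by linarith [(abs_le.mp hv).2])
    obtain ⟨l, ht, ha⟩ := exists_output_opposite hn θ hi
    set u := φ - (i + 1 / 2) * θ with hu_def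
    have hφu : φ = (i + 1 / 2) * θ + u := by rw [hu_def]; ring
    have hθπ : θ < 2 * π := by nlinarith
    have hT : n * (outputTime n θ (l + 1) + x) < (n + 1) * π := by
      rw [ht]
      nlinarith
    -- Being nearly antipodal to this output leaves at most `x - θ / 2 + |u|` for the distance to
    -- each of the two inputs.
    have hopp : π - |u| ≤ circleDist (φ - outputAngle n θ (l + 1)) := by
      have hu1 := le_abs_self u
      have hu2 := neg_le_abs u
      rcases ha with ha | ha <;> rw [ha]
      · rw [show φ - ((i + 1 / 2) * θ + π) = u - π by rw [hu_def]; ring]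
        apply le_circleDist <;> rw [abs_of_nonpos (show u - π ≤ 0 by linarith)] <;> linarith
      · rw [show φ - ((i + 1 / 2) * θ - π) = u + π by rw [hu_def]; ring]
        apply le_circleDist <;> rw [abs_of_nonneg (show 0 ≤ u + π by linarith)] <;> linarith
    have bj := bound l hT j (Or.inl rfl)
    have bk := bound l hT k (Or.inr rfl)
    rw [ht] at bj bk
    have := lt_circleDist_of_mem_gap hx0 hx hadm hi hu hjk k.2
    rw [← hφu] at this
    rcases this with h | h <;> linarith
  · obtain ⟨l, ht, ha⟩ := exists_output_central hn θ
    have hT : n * (outputTime n θ (l + 1) + x) < (n + 1) * π := by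
      rw [ht]
      nlinarith
    have bj := bound l hT j (Or.inl rfl)
    have bk := bound l hT k (Or.inr rfl)
    have hcd : circleDist (φ - (n - 1) / 2 * θ) = |φ - (n - 1) / 2 * θ| := by
      rw [← shift, hw, hφ]
      ring_nf
    rw [ht, ha, hcd] at bj bk
    have := lt_circleDist_of_outside hx0 hx hadm hv.le hjk k.2
    rw [add_sub_cancel] at this
    rcases this with h | h <;> linarith

theorem scatteringRegion_eq_empty {n : ℕ} (hn : 2 ≤ n) {M θ x : ℝ}
    (hM : -((n : ℝ) ^ 2 / ((n : ℝ) + 1) ^ 2) < M) (hM0 : M < 0) (h : IsAdmissible n θ x)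
    {j k : Fin n} (hjk : j ≠ k) : scatteringRegion M θ x j k = ∅ := by
  rcases lt_or_gt_of_ne hjk with hlt | hlt
  · exact scatteringRegion_eq_empty_of_lt hn hM hM0 h hlt
  · rw [scatteringRegion, inter_comm (causalFuture M _)]
    exact scatteringRegion_eq_empty_of_lt hn hM hM0 h hlt

theorem not_holographicScattering {n : ℕ} (hn : 2 ≤ n) {M θ x : ℝ}
    (hM : -((n : ℝ) ^ 2 / ((n : ℝ) + 1) ^ 2) < M) (hM0 : M < 0) (h : IsAdmissible n θ x) :
    ¬ HolographicScattering M n θ x := by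
  have hbot : causalGraph M n θ x = ⊥ := by
    ext j k
    simp only [causalGraph, SimpleGraph.bot_adj, iff_false, not_and]
    intro hjk
    rw [scatteringRegion_eq_empty hn hM hM0 h hjk]
    exact not_nonempty_empty
  have : Nontrivial (Fin n) := Fin.nontrivial_iff_two_le.mpr hn
  rw [HolographicScattering, hbot]
  exact SimpleGraph.not_connected_bot

end ConicalDefect

open ConicalDefect in
theorem mainTheorem5 (n : ℕ) (hn : 2 ≤ n) (M : ℝ)
    (hM : -((n : ℝ) ^ 2 / ((n : ℝ) + 1) ^ 2) < M) (hM0 : M < 0) :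
    (∀ θ x : ℝ, IsAdmissible n θ x →
      (∀ j k : Fin n, j ≠ k → scatteringRegion M θ x j k = ∅) ∧
        ¬ HolographicScattering M n θ x) ∧
    (∀ ε : ℝ, 0 < ε → ∀ C : Set (RTCandidate n → WithTop ℝ),
      (∃ θ x : ℝ, IsAdmissible n θ x ∧
        (fun A : RTCandidate n => A.length M ε θ x) ∈ C) →
      ¬ ∀ θ x : ℝ, IsAdmissible n θ x →
        (fun A : RTCandidate n => A.length M ε θ x) ∈ C → HolographicScattering M n θ x) := by
  refine ⟨fun θ x h => ⟨fun j k hjk => scatteringRegion_eq_empty hn hM hM0 h hjk,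
    not_holographicScattering hn hM hM0 h⟩, ?_⟩
  -- Scattering fails everywhere, so the pair at which `C` holds is itself the counterexample.
  rintro ε - C ⟨θ, x, h, hC⟩ himp
  exact not_holographicScattering hn hM hM0 h (himp θ x h hC)
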